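/- Let $d \ge 2$ be an integer, and let $u, v$ be independent random vectors, each uniformly distributed on the unit sphere $\mathbb{S}^{d-1} = \{x \in \mathbb{R}^d : \|x\| = 1\}$ (that is, distributed according to the normalized surface measure). Let $X = \langle u, v\rangle$ and $Y = \frac{X+1}{2}$. Then $Y$ has the $\mathrm{Beta}\left(\frac{d-1}{2}, \frac{d-1}{2}\right)$ distribution. Moreover, $X$ has a density with respect to Lebesgue measure on $\mathbb{R}$, which is $c\,(1-x^2)^{\frac{d-3}{2}}$ for $-1 < x < 1$ and $0$ elsewhere, for some constant $c > 0$. -/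

import Mathlib

open MeasureTheory ProbabilityTheory

/-! Surface measure of a set on the sphere is `d` times the volume of the cone over it. Hence, for a
unit vector `e`, the law of `⟨e, s⟩` is found from the volume of the `y` in the unit ball with `⟨e,
y⟩ / ‖y‖ ∈ A`. Write `y = (t, w)` with `t` along `e`. For fixed `w`, substitute `x = t / √(t² +
‖w‖²)`; then swap the integrals and scale the ball in `w`. The density is proportional to `(1 - x²)
^ ((d - 3) / 2)`, whatever `e` is, so by independence `⟨u, v⟩` has this law too. The constant need
not be computed: the image of the Beta law under `y ↦ 2 * y - 1` is a multiple of the same measure,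
and two proportional probability measures agree. -/

theorem exists_measurePreserving_prod_of_norm_eq_one
    {E F : Type*} [NormedAddCommGroup E] [InnerProductSpace ℝ E] [FiniteDimensional ℝ E]
    [MeasurableSpace E] [BorelSpace E]
    [NormedAddCommGroup F] [InnerProductSpace ℝ F] [FiniteDimensional ℝ F]
    [MeasurableSpace F] [BorelSpace F]
    (h : Module.finrank ℝ E = Module.finrank ℝ F + 1) {e : E} (he : ‖e‖ = 1) :
    ∃ φ : ℝ × F → E, MeasurePreserving φ ∧
      ∀ p, ‖φ p‖ = √(p.1 ^ 2 + ‖p.2‖ ^ 2) ∧ inner ℝ e (φ p) = p.1 := by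
  let W := WithLp 2 (ℝ × F)
  have hW : Module.finrank ℝ W = Module.finrank ℝ E := by
    rw [h, (WithLp.linearEquiv 2 ℝ (ℝ × F)).finrank_eq, Module.finrank_prod, Module.finrank_self,
      add_comm]
  let M : W ≃ₗᵢ[ℝ] E := 
    (stdOrthonormalBasis ℝ W).equiv (stdOrthonormalBasis ℝ E) (finCongr hW)
  let e₀ : W := WithLp.toLp 2 (1, 0)
  have he₀ : ‖e₀‖ = 1 := by
    rw [WithLp.prod_norm_eq_of_L2]
    simp [e₀]
  -- This reflection swaps the unit vectors `M e₀` and `e`.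
  let L : W ≃ₗᵢ[ℝ] E := M.trans (Submodule.reflection (ℝ ∙ (M e₀ - e))ᗮ)
  have hL : L e₀ = e := Submodule.reflection_sub (by rw [M.norm_map, he₀, he])
  refine ⟨fun p ↦ L (WithLp.toLp 2 p),
    L.measurePreserving.comp (WithLp.volume_preserving_toLp ℝ F), fun p ↦ ⟨?_, ?_⟩⟩
  · rw [L.norm_map, WithLp.prod_norm_eq_of_L2]
    simp
  · rw [← hL, L.inner_map_map, WithLp.prod_inner_apply]
    simp [e₀]

/-- Change of variables `t = r * x / √(1 - x²)`, the inverse of `x = t / √(t² + r²)`. Since `t² + r²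
= r² / (1 - x²)`, the ball condition turns into `x² + r² < 1`. -/
theorem volume_setOf_div_sqrt_mem {r : ℝ} (hr : 0 < r) {A : Set ℝ} (hA : MeasurableSet A) :
    volume {t : ℝ | t ^ 2 + r ^ 2 < 1 ∧ t / √(t ^ 2 + r ^ 2) ∈ A} =
      ∫⁻ x in A ∩ {x | x ^ 2 + r ^ 2 < 1}, ENNReal.ofReal (r * (1 - x ^ 2) ^ (-(3 / 2) : ℝ)) := by
  set S : Set ℝ := A ∩ {x | x ^ 2 + r ^ 2 < 1} with hS
  have hSm : MeasurableSet S := hA.inter (measurableSet_lt (by fun_prop) (by fun_prop))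
  have hpos : ∀ x ∈ S, 0 < 1 - x ^ 2 := fun x hx ↦ by
    have := hx.2
    simp only [Set.mem_ofPred_eq] at this
    nlinarith [sq_pos_of_pos hr]
  let φ : ℝ → ℝ := fun x ↦ r * x / √(1 - x ^ 2)
  have hφ : ∀ x ∈ S, φ x ^ 2 + r ^ 2 = r ^ 2 / (1 - x ^ 2) := fun x hx ↦ by
    have := hpos x hx
    simp only [φ, div_pow, Real.sq_sqrt this.le]
    field_simp
    ring
  have hinv : ∀ x ∈ S, φ x / √(φ x ^ 2 + r ^ 2) = x := fun x hx ↦ by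
    have := Real.sqrt_pos.2 (hpos x hx)
    rw [hφ x hx, Real.sqrt_div (by positivity), Real.sqrt_sq hr.le]
    simp only [φ]
    field_simp
  have himg : φ '' S = {t : ℝ | t ^ 2 + r ^ 2 < 1 ∧ t / √(t ^ 2 + r ^ 2) ∈ A} := by
    ext t
    constructor
    · rintro ⟨x, hx, rfl⟩
      refine ⟨?_, by rw [hinv x hx]; exact hx.1⟩
      rw [hφ x hx, div_lt_one (hpos x hx)]
      have := hx.2
      simp only [Set.mem_ofPred_eq] at this
      linarith
    · rintro ⟨h1, h2⟩
      have hq : 0 < t ^ 2 + r ^ 2 := by positivity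
      have hs := Real.sqrt_pos.2 hq
      have h3 : 1 - (t / √(t ^ 2 + r ^ 2)) ^ 2 = r ^ 2 / (t ^ 2 + r ^ 2) := by
        rw [div_pow, Real.sq_sqrt hq.le]
        field_simp
        ring
      refine ⟨t / √(t ^ 2 + r ^ 2), ⟨h2, ?_⟩, ?_⟩
      · have : r ^ 2 < r ^ 2 / (t ^ 2 + r ^ 2) := by
          rw [lt_div_iff₀ hq]
          nlinarith [sq_pos_of_pos hr]
        simp only [Set.mem_ofPred_eq]
        linarith
      · simp only [φ]
        rw [h3, Real.sqrt_div (by positivity), Real.sqrt_sq hr.le]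
        field_simp
  have hder : ∀ x ∈ S, HasDerivWithinAt φ (r * (1 - x ^ 2) ^ (-(3 / 2) : ℝ)) S x := fun x hx ↦ by
    have h0 := hpos x hx
    have hs := Real.sqrt_pos.2 h0
    have h1 : HasDerivAt (fun x : ℝ ↦ 1 - x ^ 2) (-(2 * x)) x := by
      simpa using (hasDerivAt_pow 2 x).const_sub 1
    have h2 := ((hasDerivAt_id x).const_mul r).div (h1.sqrt h0.ne') hs.ne'
    refine (h2.congr_deriv ?_).hasDerivWithinAt
    have h3 : (1 - x ^ 2) ^ (-(3 / 2) : ℝ) = 1 / ((1 - x ^ 2) * √(1 - x ^ 2)) := by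
      rw [Real.rpow_neg h0.le, show (3 / 2 : ℝ) = 1 + 1 / 2 by norm_num, Real.rpow_add h0,
        Real.rpow_one, ← Real.sqrt_eq_rpow, one_div]
    rw [h3, Real.sq_sqrt h0.le]
    have h4 := Real.sq_sqrt h0.le
    simp only [id]
    field_simp
    rw [h4]
    ring
  have hinj : Set.InjOn φ S := fun x hx y hy hxy ↦ by
    rw [← hinv x hx, ← hinv y hy, hxy]
  have := lintegral_image_eq_lintegral_abs_deriv_mul hSm hder hinj (fun _ ↦ 1)
  rw [himg] at this
  simp only [lintegral_const, one_mul, mul_one, Measure.restrict_apply_univ] at this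
  rw [this]
  refine setLIntegral_congr_fun hSm fun x hx ↦ ?_
  have := hpos x hx
  rw [abs_of_pos (by positivity)]

/-- Scaling by `s`: Haar measure contributes the power `finrank ℝ F`, the integrand one more. -/
theorem setLIntegral_ball_ofReal_norm {F : Type*} [NormedAddCommGroup F] [NormedSpace ℝ F]
    [FiniteDimensional ℝ F] [MeasurableSpace F] [BorelSpace F] (μ : Measure F) [μ.IsAddHaarMeasure]
    {s : ℝ} (hs : 0 < s) :
    ∫⁻ w in Metric.ball (0 : F) s, ENNReal.ofReal ‖w‖ ∂μ =
      ENNReal.ofReal (s ^ (Module.finrank ℝ F + 1)) *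
        ∫⁻ w in Metric.ball (0 : F) 1, ENNReal.ofReal ‖w‖ ∂μ := by
  have h := congrArg (fun ν ↦ ∫⁻ w in Metric.ball (0 : F) s, ENNReal.ofReal ‖w‖ ∂ν)
    (Measure.map_addHaar_smul μ hs.ne')
  rw [Measure.restrict_smul, lintegral_smul_measure,
    setLIntegral_map Metric.isOpen_ball.measurableSet (by fun_prop) (by fun_prop)] at h
  have hpre : (fun w : F ↦ s • w) ⁻¹' Metric.ball 0 s = Metric.ball 0 1 := by
    ext w
    simp [norm_smul, abs_of_pos hs, hs]
  simp only [hpre, norm_smul, Real.norm_eq_abs, abs_of_pos hs, ENNReal.ofReal_mul hs.le] at h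
  rw [lintegral_const_mul _ (by fun_prop)] at h
  rw [pow_succ, ENNReal.ofReal_mul (by positivity), mul_assoc, h, smul_eq_mul, ← mul_assoc,
    ← ENNReal.ofReal_mul (by positivity), abs_of_pos (by positivity),
    mul_inv_cancel₀ (by positivity), ENNReal.ofReal_one, one_mul]

theorem volume_prod_setOf_div_sqrt_mem
    {F : Type*} [NormedAddCommGroup F] [NormedSpace ℝ F] [FiniteDimensional ℝ F] [Nontrivial F]
    [MeasurableSpace F] [BorelSpace F] (μ : Measure F) [μ.IsAddHaarMeasure]
    {A : Set ℝ} (hA : MeasurableSet A) :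
    ((volume : Measure ℝ).prod μ)
      {p | p.1 ^ 2 + ‖p.2‖ ^ 2 < 1 ∧ p.1 / √(p.1 ^ 2 + ‖p.2‖ ^ 2) ∈ A} =
      (∫⁻ w in Metric.ball (0 : F) 1, ENNReal.ofReal ‖w‖ ∂μ) *
        ∫⁻ x in A ∩ Set.Ioo (-1) 1,
          ENNReal.ofReal ((1 - x ^ 2) ^ (((Module.finrank ℝ F : ℝ) - 2) / 2)) := by
  set K := ∫⁻ w in Metric.ball (0 : F) 1, ENNReal.ofReal ‖w‖ ∂μ
  have hm : MeasurableSet {p : ℝ × F | p.1 ^ 2 + ‖p.2‖ ^ 2 < 1 ∧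
      p.1 / √(p.1 ^ 2 + ‖p.2‖ ^ 2) ∈ A} := by
    refine MeasurableSet.inter (s₁ := {p : ℝ × F | p.1 ^ 2 + ‖p.2‖ ^ 2 < 1})
      (measurableSet_lt (by fun_prop) (by fun_prop)) ?_
    exact measurableSet_preimage (f := fun p : ℝ × F ↦ p.1 / √(p.1 ^ 2 + ‖p.2‖ ^ 2))
      (by fun_prop) hA
  -- The slice formula needs `r = ‖w‖ > 0`.
  have hne : ∀ᵐ w ∂μ, w ≠ 0 := by simp [ae_iff]
  let B : Set (F × ℝ) := {q | q.2 ∈ A ∧ q.2 ^ 2 + ‖q.1‖ ^ 2 < 1}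
  have hB : MeasurableSet B := by
    refine (measurable_snd hA).inter (s₂ := {q : F × ℝ | q.2 ^ 2 + ‖q.1‖ ^ 2 < 1}) ?_
    exact measurableSet_lt (by fun_prop) (by fun_prop)
  let g : F → ℝ → ENNReal := fun w x ↦
    B.indicator (fun q ↦ ENNReal.ofReal (‖q.1‖ * (1 - q.2 ^ 2) ^ (-(3 / 2) : ℝ))) (w, x)
  have hg : Measurable (Function.uncurry g) := Measurable.indicator (by fun_prop) hB
  rw [Measure.prod_apply_symm hm]
  calc _ = ∫⁻ w, ∫⁻ x, g w x ∂volume ∂μ := by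
        refine lintegral_congr_ae (hne.mono fun w hw ↦ ?_)
        refine (volume_setOf_div_sqrt_mem (norm_pos_iff.2 hw) hA).trans ?_
        rw [← lintegral_indicator (hA.inter (measurableSet_lt (by fun_prop) (by fun_prop)))]
        rfl
    _ = ∫⁻ x, ∫⁻ w, g w x ∂μ ∂volume := lintegral_lintegral_swap hg.aemeasurable
    _ = ∫⁻ x, (A ∩ Set.Ioo (-1) 1).indicator (fun x ↦
          K * ENNReal.ofReal ((1 - x ^ 2) ^ (((Module.finrank ℝ F : ℝ) - 2) / 2))) x := by
        refine lintegral_congr fun x ↦ ?_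
        by_cases hx : x ∈ A ∩ Set.Ioo (-1) 1
        · have h0 : 0 < 1 - x ^ 2 := by nlinarith [hx.2.1, hx.2.2]
          have hs := Real.sqrt_pos.2 h0
          have hgx : ∀ w, g w x = (Metric.ball (0 : F) √(1 - x ^ 2)).indicator
              (fun w ↦ ENNReal.ofReal ((1 - x ^ 2) ^ (-(3 / 2) : ℝ)) * ENNReal.ofReal ‖w‖) w := by
            intro w
            have : (w, x) ∈ B ↔ w ∈ Metric.ball (0 : F) √(1 - x ^ 2) := by
              rw [mem_ball_zero_iff, Real.lt_sqrt (norm_nonneg w), lt_sub_iff_add_lt']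
              exact and_iff_right hx.1
            simp only [← ENNReal.ofReal_mul (Real.rpow_nonneg h0.le _),
              mul_comm ((1 - x ^ 2) ^ (-(3 / 2) : ℝ))]
            by_cases hw : (w, x) ∈ B
            · simp only [g, Set.indicator_of_mem hw, Set.indicator_of_mem (this.1 hw)]
            · simp only [g, Set.indicator_of_notMem hw, Set.indicator_of_notMem (mt this.2 hw)]
          simp only [hgx]
          rw [lintegral_indicator Metric.isOpen_ball.measurableSet,
            lintegral_const_mul _ (by fun_prop), setLIntegral_ball_ofReal_norm μ hs,
            Set.indicator_of_mem hx, ← mul_assoc, ← ENNReal.ofReal_mul (by positivity), mul_comm]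
          congr 2
          -- With `n = finrank ℝ F`, the exponents add up to `-3/2 + (n + 1)/2 = (n - 2)/2`.
          rw [Real.sqrt_eq_rpow, ← Real.rpow_natCast _ (Module.finrank ℝ F + 1), ← Real.rpow_mul h0.le, ← Real.rpow_add h0]
          congr 1
          push_cast
          ring
        · rw [Set.indicator_of_notMem hx]
          have : ∀ w, g w x = 0 := fun w ↦ by
            refine Set.indicator_of_notMem (fun h ↦ hx ⟨h.1, ?_⟩) _
            have h1 := h.2
            simp only at h1
            exact abs_lt.1 ((sq_lt_one_iff_abs_lt_one x).1 (by nlinarith [sq_nonneg ‖w‖]))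
          simp [this]
    _ = _ := by
        rw [lintegral_indicator (hA.inter measurableSet_Ioo), lintegral_const_mul]
        fun_prop

-- That `κ` is chosen before `e` is the rotation invariance used to integrate out the first vector.
open scoped Pointwise in
theorem exists_map_inner_toSphere_eq
    (E : Type*) [NormedAddCommGroup E] [InnerProductSpace ℝ E] [FiniteDimensional ℝ E]
    [MeasurableSpace E] [BorelSpace E] (h : 2 ≤ Module.finrank ℝ E) :
    ∃ κ : ENNReal, ∀ e : E, ‖e‖ = 1 →
      (volume : Measure E).toSphere.map (fun s : Metric.sphere (0 : E) 1 ↦ inner ℝ e (s : E)) =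
        κ • volume.withDensity (fun x ↦ ENNReal.ofReal ((Set.Ioo (-1 : ℝ) 1).indicator
          (fun t ↦ (1 - t ^ 2) ^ (((Module.finrank ℝ E : ℝ) - 3) / 2)) x)) := by
  let F := EuclideanSpace ℝ (Fin (Module.finrank ℝ E - 1))
  have hF : Module.finrank ℝ E = Module.finrank ℝ F + 1 := by
    simp only [F, finrank_euclideanSpace_fin]
    omega
  have : Nontrivial F := Module.nontrivial_of_finrank_pos (R := ℝ) (by omega)
  refine ⟨Module.finrank ℝ E * ∫⁻ w in Metric.ball (0 : F) 1, ENNReal.ofReal ‖w‖,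
    fun e he ↦ ?_⟩
  obtain ⟨φ, hφ, hφ'⟩ := exists_measurePreserving_prod_of_norm_eq_one (F := F) hF he
  have hmeas : Measurable fun s : Metric.sphere (0 : E) 1 ↦ inner ℝ e (s : E) := by fun_prop
  ext A hA
  -- The apex is missing because the radii are positive; it is a null set.
  have hcone : Set.Ioo (0 : ℝ) 1 • (Subtype.val '' ((fun s : Metric.sphere (0 : E) 1 ↦
      inner ℝ e (s : E)) ⁻¹' A)) = {y : E | ‖y‖ < 1 ∧ inner ℝ e y / ‖y‖ ∈ A} \ {0} := by
    ext y
    constructor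
    · rintro ⟨r, hr, _, ⟨s, hs, rfl⟩, rfl⟩
      have hs1 : ‖(s : E)‖ = 1 := by simp
      have hn : ‖r • (s : E)‖ = r := by rw [norm_smul, hs1, mul_one, Real.norm_of_nonneg hr.1.le]
      refine ⟨⟨hn.trans_lt hr.2, ?_⟩, fun h0 ↦ hr.1.ne' ?_⟩
      · simp only [hn, inner_smul_right]
        rw [mul_div_cancel_left₀ _ hr.1.ne']
        exact hs
      · rw [← hn]
        exact norm_eq_zero.2 h0
    · rintro ⟨⟨h1, h2⟩, h0⟩
      have hy : 0 < ‖y‖ := norm_pos_iff.2 h0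
      refine ⟨‖y‖, ⟨hy, h1⟩, ‖y‖⁻¹ • y, ⟨⟨‖y‖⁻¹ • y, ?_⟩, ?_, rfl⟩, ?_⟩
      · simp [norm_smul, hy.ne']
      · simpa [inner_smul_right, div_eq_inv_mul] using h2
      · simp [smul_smul, hy.ne']
  have hcm : MeasurableSet {y : E | ‖y‖ < 1 ∧ inner ℝ e y / ‖y‖ ∈ A} := by
    refine MeasurableSet.inter (s₁ := {y : E | ‖y‖ < 1})
      (measurableSet_lt (by fun_prop) (by fun_prop)) ?_
    exact measurableSet_preimage (f := fun y : E ↦ inner ℝ e y / ‖y‖) (by fun_prop) hA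
  have : Nontrivial E := Module.nontrivial_of_finrank_pos (R := ℝ) (by omega)
  have hpre : φ ⁻¹' {y : E | ‖y‖ < 1 ∧ inner ℝ e y / ‖y‖ ∈ A} =
      {p | p.1 ^ 2 + ‖p.2‖ ^ 2 < 1 ∧ p.1 / √(p.1 ^ 2 + ‖p.2‖ ^ 2) ∈ A} := by
    ext p
    simp only [Set.mem_preimage, Set.mem_ofPred_eq, (hφ' p).1, (hφ' p).2]
    rw [Real.sqrt_lt' one_pos, one_pow]
  rw [Measure.map_apply hmeas hA, Measure.toSphere_apply' _ (hmeas hA), hcone,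
    measure_sdiff_null (measure_singleton _), ← hφ.measure_preimage hcm.nullMeasurableSet, hpre,
    Measure.volume_eq_prod, volume_prod_setOf_div_sqrt_mem _ hA, Measure.smul_apply, smul_eq_mul,
    withDensity_apply _ hA, ← mul_assoc]
  congr 1
  rw [Set.inter_comm, ← setLIntegral_indicator measurableSet_Ioo]
  refine lintegral_congr fun x ↦ ?_
  have hexp : ((Module.finrank ℝ F : ℝ) - 2) / 2 = ((Module.finrank ℝ E : ℝ) - 3) / 2 := by
    have hF' : (Module.finrank ℝ E : ℝ) = Module.finrank ℝ F + 1 := by exact_mod_cast hF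
    rw [hF']
    ring
  by_cases hx : x ∈ Set.Ioo (-1 : ℝ) 1 <;> simp [hx, hexp]

theorem map_inner_prod_eq
    {E : Type*} [NormedAddCommGroup E] [InnerProductSpace ℝ E]
    [MeasurableSpace E] [BorelSpace E] [SecondCountableTopology E]
    (μ ν : Measure (Metric.sphere (0 : E) 1)) [IsProbabilityMeasure μ] [SFinite ν] (ρ : Measure ℝ)
    (h : ∀ e : E, ‖e‖ = 1 → ν.map (fun s : Metric.sphere (0 : E) 1 ↦ inner ℝ e (s : E)) = ρ) :
    (μ.prod ν).map (fun p ↦ inner ℝ (p.1 : E) (p.2 : E)) = ρ := by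
  have hm : Measurable fun p : Metric.sphere (0 : E) 1 × Metric.sphere (0 : E) 1 ↦
      inner ℝ (p.1 : E) (p.2 : E) := by fun_prop
  ext A hA
  rw [Measure.map_apply hm hA, Measure.prod_apply (hm hA)]
  calc _ = ∫⁻ _, ρ A ∂μ := by
        refine lintegral_congr fun s ↦ ?_
        rw [← h s (by simp), Measure.map_apply (by fun_prop) hA]
        rfl
    _ = ρ A := by simp

theorem map_betaMeasure_self_two_mul_sub_one (a : ℝ) :
    (betaMeasure a a).map (fun y ↦ 2 * y - 1) =
      volume.withDensity (fun x ↦ ENNReal.ofReal ((Set.Ioo (-1 : ℝ) 1).indicator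
        (fun t ↦ (2 ^ (2 * a - 1) * beta a a)⁻¹ * (1 - t ^ 2) ^ (a - 1)) x)) := by
  ext A hA
  have himg : (fun y : ℝ ↦ 2 * y - 1) ⁻¹' A = (fun x : ℝ ↦ (x + 1) / 2) '' A := by
    ext y
    constructor
    · exact fun hy ↦ ⟨2 * y - 1, hy, by ring⟩
    · rintro ⟨x, hx, rfl⟩
      simpa [mul_div_cancel₀] using hx
  have hder : ∀ x ∈ A, HasDerivWithinAt (fun x : ℝ ↦ (x + 1) / 2) (1 / 2) A x := fun x _ ↦
    (((hasDerivAt_id x).add_const 1).div_const 2).hasDerivWithinAt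
  have hinj : Set.InjOn (fun x : ℝ ↦ (x + 1) / 2) A := fun x _ y _ hxy ↦ by
    simpa using hxy
  have hm : Measurable fun y : ℝ ↦ 2 * y - 1 := by fun_prop
  rw [Measure.map_apply hm hA, betaMeasure, withDensity_apply _ (hm hA), himg,
    lintegral_image_eq_lintegral_abs_deriv_mul hA hder hinj, withDensity_apply _ hA]
  refine lintegral_congr fun x ↦ ?_
  rw [abs_of_pos (by norm_num), betaPDF, ← ENNReal.ofReal_mul (by norm_num), betaPDFReal]
  congr 1
  by_cases hx : x ∈ Set.Ioo (-1 : ℝ) 1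
  · have h1 : 0 < 1 + x := by linarith [hx.1]
    have h2 : 0 < 1 - x := by linarith [hx.2]
    rw [if_pos ⟨by linarith, by linarith⟩, Set.indicator_of_mem hx,
      show 1 - (x + 1) / 2 = (1 - x) / 2 by ring, add_comm x 1,
      Real.div_rpow h1.le zero_le_two, Real.div_rpow h2.le zero_le_two,
      show 1 - x ^ 2 = (1 + x) * (1 - x) by ring, Real.mul_rpow h1.le h2.le,
      show 2 * a - 1 = (a - 1) + (a - 1) + 1 by ring, Real.rpow_add_one two_ne_zero,
      Real.rpow_add two_pos]
    field_simp
  · rw [if_neg fun h ↦ hx ⟨by linarith [h.1], by linarith [h.2]⟩, Set.indicator_of_notMem hx,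
      mul_zero]

/-- Total mass one forces both scalars to be the inverse of `m Set.univ`. -/
theorem smul_eq_smul_of_isProbabilityMeasure {α : Type*} [MeasurableSpace α] {m : Measure α}
    {a b : ENNReal} (ha : IsProbabilityMeasure (a • m)) (hb : IsProbabilityMeasure (b • m)) :
    a • m = b • m := by
  have ha' := ha.measure_univ
  have hb' := hb.measure_univ
  rw [Measure.smul_apply, smul_eq_mul] at ha' hb'
  rw [ENNReal.eq_inv_of_mul_eq_one_left ha', ENNReal.eq_inv_of_mul_eq_one_left hb']

/-- `volume.toSphere` is the surface measure on the unit sphere of `ℝ^d`; `pdf.IsUniform u univ P μ`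
says that the law of `u` under `P` is `μ` normalized to total mass one. -/
theorem mainTheorem2 (d : ℕ) (hd : 2 ≤ d)
    {Ω : Type*} [MeasurableSpace Ω] (P : Measure Ω) [IsProbabilityMeasure P]
    (u v : Ω → Metric.sphere (0 : EuclideanSpace ℝ (Fin d)) 1)
    (hu : pdf.IsUniform u Set.univ P (volume : Measure (EuclideanSpace ℝ (Fin d))).toSphere)
    (hv : pdf.IsUniform v Set.univ P (volume : Measure (EuclideanSpace ℝ (Fin d))).toSphere)
    (huv : IndepFun u v P) :
    HasLaw
      (fun ω ↦ (inner ℝ (u ω : EuclideanSpace ℝ (Fin d)) (v ω : EuclideanSpace ℝ (Fin d)) + 1) / 2)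
      (betaMeasure (((d : ℝ) - 1) / 2) (((d : ℝ) - 1) / 2)) P ∧
    ∃ c : ℝ, 0 < c ∧
      HasLaw
        (fun ω ↦ inner ℝ (u ω : EuclideanSpace ℝ (Fin d)) (v ω : EuclideanSpace ℝ (Fin d)))
        (volume.withDensity fun x : ℝ ↦ ENNReal.ofReal
          ((Set.Ioo (-1 : ℝ) 1).indicator (fun t ↦ c * (1 - t ^ 2) ^ (((d : ℝ) - 3) / 2)) x)) P := by
  let E := EuclideanSpace ℝ (Fin d)
  have hE : Module.finrank ℝ E = d := finrank_euclideanSpace_fin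
  have : Nontrivial E := Module.nontrivial_of_finrank_pos (R := ℝ) (by omega)
  set σ : Measure (Metric.sphere (0 : E) 1) := (volume : Measure E).toSphere with hσ
  have hσ0 : σ Set.univ ≠ 0 := Measure.measure_univ_ne_zero.2 (Measure.toSphere_ne_zero _)
  have hσt : σ Set.univ ≠ ⊤ := measure_ne_top σ _
  have hum : AEMeasurable u P := hu.aemeasurable hσ0 hσt
  have hvm : AEMeasurable v P := hv.aemeasurable hσ0 hσt
  have hd1 : (1 : ℝ) < d := by exact_mod_cast hd
  set a : ℝ := ((d : ℝ) - 1) / 2 with ha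
  have ha0 : 0 < a := by rw [ha]; linarith
  set c : ℝ := (2 ^ (2 * a - 1) * beta a a)⁻¹ with hc
  have hc0 : 0 < c := by
    have := beta_pos ha0 ha0
    positivity
  set m : Measure ℝ := volume.withDensity (fun x ↦ ENNReal.ofReal ((Set.Ioo (-1 : ℝ) 1).indicator
    (fun t ↦ (1 - t ^ 2) ^ (((d : ℝ) - 3) / 2)) x)) with hm
  have hbeta := map_betaMeasure_self_two_mul_sub_one a
  rw [← hc, show a - 1 = ((d : ℝ) - 3) / 2 by rw [ha]; ring] at hbeta
  have hcm : volume.withDensity (fun x ↦ ENNReal.ofReal ((Set.Ioo (-1 : ℝ) 1).indicator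
      (fun t ↦ c * (1 - t ^ 2) ^ (((d : ℝ) - 3) / 2)) x)) = ENNReal.ofReal c • m := by
    rw [hm, ← withDensity_smul' _ _ ENNReal.ofReal_ne_top]
    congr 1
    ext x
    rw [Set.indicator_const_mul, ENNReal.ofReal_mul hc0.le]
    rfl
  obtain ⟨κ, hκ⟩ := exists_map_inner_toSphere_eq E (by omega)
  rw [hE, ← hm] at hκ
  let X : Ω → ℝ := fun ω ↦ inner ℝ (u ω : E) (v ω : E)
  have hXm : AEMeasurable X P := by fun_prop
  have : IsProbabilityMeasure (ProbabilityTheory.cond σ Set.univ) := cond_isProbabilityMeasure hσ0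
  have hX : P.map X = ((σ Set.univ)⁻¹ * κ) • m := by
    have h1 : P.map X = (P.map fun ω ↦ (u ω, v ω)).map
        (fun p ↦ inner ℝ (p.1 : E) (p.2 : E)) := by
      rw [AEMeasurable.map_map_of_aemeasurable (by fun_prop) (hum.prodMk hvm)]
      rfl
    rw [h1, (indepFun_iff_map_prod_eq_prod_map_map hum hvm).1 huv, hu, hv]
    refine map_inner_prod_eq _ _ _ fun e he ↦ ?_
    have hcond : ProbabilityTheory.cond σ Set.univ = (σ Set.univ)⁻¹ • σ := by
      simp [ProbabilityTheory.cond]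
    rw [hcond, Measure.map_smul, hκ e he, smul_smul]
  have hlaw : P.map X = ENNReal.ofReal c • m := by
    have h1 := Measure.isProbabilityMeasure_map hXm
    have := isProbabilityMeasureBeta ha0 ha0
    have h2 : IsProbabilityMeasure ((betaMeasure a a).map fun y ↦ 2 * y - 1) :=
      Measure.isProbabilityMeasure_map (by fun_prop)
    rw [hX] at h1 ⊢
    rw [hbeta, hcm] at h2
    exact smul_eq_smul_of_isProbabilityMeasure h1 h2
  refine ⟨⟨by fun_prop, ?_⟩, c, hc0, ⟨hXm, by rw [hcm]; exact hlaw⟩⟩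
  calc P.map (fun ω ↦ (X ω + 1) / 2) = (P.map X).map (fun x ↦ (x + 1) / 2) := by
        rw [AEMeasurable.map_map_of_aemeasurable (by fun_prop) hXm]
        rfl
    _ = betaMeasure a a := by
        rw [hlaw, ← hcm, ← hbeta, Measure.map_map (by fun_prop) (by fun_prop)]
        convert! Measure.map_id
        ext y
        simp
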